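/- An $r$-colouring of a graph is a colouring of its edges with colours from $\{1,\dots,r\}$ (not all colours need be used). A colour class of a subgraph $S$ of an edge-coloured graph, i.e. the set of edges of $S$ of a given colour, is called odd if it has an odd number of edges. The odd-Ramsey number $r_{odd}(n,H)$ is the least $r\ge 1$ for which there is an $r$-colouring of the complete graph $K_n$ such that every copy of $H$ in $K_n$ has an odd colour class. Let $C_n$ be the cycle on $n$ vertices. If $r\ge 2$ and $n\ge 2r^2+40r^{3/2}$ are integers, then every $r$-colouring of $K_n$ contains a Hamilton cycle with at most one odd colour class. In particular, there is a function $\varepsilon:\mathbb{N}\to\mathbb{R}$ with $\varepsilon(n)\to 0$ as $n\to\infty$ such that, for every even integer $n\ge 4$, $$r_{odd}(n,C_n)\ \ge\ \Big(\frac{\sqrt 2}{2}+\varepsilon(n)\Big)\sqrt n .$$ -/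

import Mathlib

namespace OddRamsey

/-- Given an edge-colouring `c` of `G`, the colour class of `k` in the subgraph `S` of `G`:
the set of edges of `S` that receive the colour `k`. -/
def colourClass {V K : Type*} {G : SimpleGraph V} (c : G.EdgeLabeling K) (S : G.Subgraph)
    (k : K) : Set G.edgeSet :=
  {e | (e : Sym2 V) ∈ S.edgeSet ∧ c e = k}

/-- The set of colours that appear on an odd number of edges of the subgraph `S`.
(The vertex set is finite, so `Set.ncard` is the true number of edges.) -/
def oddColours {V K : Type*} [Finite V] {G : SimpleGraph V} (c : G.EdgeLabeling K)
    (S : G.Subgraph) : Set K :=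
  {k | Odd (colourClass c S k).ncard}

/-- The odd-Ramsey number of `H` in `G`: the least number `r ≥ 1` of colours in an edge-colouring
of `G` for which every copy of `H` in `G` has an odd colour class. A colouring need not use all
`r` colours of the palette. Such an `r` exists as soon as `H` has an edge: give distinct
colours to distinct edges. -/
noncomputable def oddRamsey {V W : Type*} [Finite V] (G : SimpleGraph V) (H : SimpleGraph W) : ℕ :=
  sInf {r : ℕ | 1 ≤ r ∧ ∃ c : G.EdgeLabeling (Fin r),
    ∀ f : SimpleGraph.Copy H G, (oddColours c f.toSubgraph).Nonempty}

end OddRamsey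

/-! Give an edge of colour `j` the vector `e_j` in `F_2^r`. It suffices to find a Hamilton cycle
whose edge vectors sum to `n • e_i` for some `i`: this is `0` for even `n` and has one odd class for
odd `n`. Swapping the two middle vertices of a path on four vertices changes the sum by the vector
of a 4-cycle, so disjoint quadruples placed along the cycle allow corrections by any element of the
span of their vectors.

A largest family of disjoint quadruples with independent vectors has at most `r` members. An
exchange argument (`exists_closed_exchange`) drops some of them so that the span `U` of the rest
contains the vector of every quadruple of unused vertices, even when the vertices of any one kept
quadruple are allowed as well. When all 4-cycle sums vanish modulo `U`, the edge vectors have the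
form `g v + g w + e_i` (`edgeVec_add_mem_of_quadVec_mem`). Around a closed tour the potentials `g`
cancel in pairs and `n • e_i` is left.

There remain `O(r)` vertices outside the pool and the kept quadruples. Each behaves between pool
vertices as if it had a potential, or else yields a new swap that enlarges the span
(`IsLayout.exists_neutral`). The latter happens at most `r` times. The tour then has sum `n • e_i`
modulo the available swaps, and the swaps remove the discrepancy (`exists_flips`). -/

namespace OddRamsey

/-! ### Linear algebra: exchanging members of a maximal independent system. -/

section Exchange

variable {K V M : Type*} [Field K] [AddCommGroup M] [Module K M]

/-- A family of pairwise disjoint quadruples of distinct vertices whose vectors are linearly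
independent. -/
def IsIndepSystem (K : Type*) {V M ι : Type*} [Field K] [AddCommGroup M] [Module K M]
    (vec : (Fin 4 → V) → M) (q : ι → Fin 4 → V) : Prop :=
  Function.Injective (Function.uncurry q) ∧ LinearIndependent K (fun i => vec (q i))

theorem exists_maximal_indepSystem [FiniteDimensional K M] (vec : (Fin 4 → V) → M) :
    ∃ d ≤ Module.finrank K M, ∃ q : Fin d → Fin 4 → V, IsIndepSystem K vec q ∧
      ∀ q' : Option (Fin d) → Fin 4 → V, ¬ IsIndepSystem K vec q' := by
  classical
  let P : ℕ → Prop := fun d => ∃ q : Fin d → Fin 4 → V, IsIndepSystem K vec q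
  have h0 : P 0 := ⟨Fin.elim0, fun x => x.1.elim0, linearIndependent_empty_type⟩
  have hb : ∀ d, P d → d ≤ Module.finrank K M := by
    rintro d ⟨q, -, hq⟩
    simpa using hq.fintype_card_le_finrank
  have hsucc : ∀ d (q' : Option (Fin d) → Fin 4 → V), IsIndepSystem K vec q' → P (d + 1) := by
    rintro d q' ⟨hq1, hq2⟩
    refine ⟨fun i => q' (finSuccEquiv d i), ?_, hq2.comp _ (finSuccEquiv d).injective⟩
    rintro ⟨i, a⟩ ⟨j, b⟩ h
    have := hq1 (a₁ := (finSuccEquiv d i, a)) (a₂ := (finSuccEquiv d j, b)) h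
    simpa using this
  refine ⟨Nat.findGreatest P (Module.finrank K M), Nat.findGreatest_le _,
    (Nat.findGreatest_spec (P := P) (Nat.zero_le _) h0).imp fun q hq => ⟨hq, ?_⟩⟩
  intro q' hq'
  have hP := hsucc _ q' hq'
  have := Nat.le_findGreatest (hb _ hP) hP
  omega

/-- The vertices that lie in none of the quadruples `q i` nor in `F i` for `i ∈ J`. -/
def unused {ι : Type*} (q F : ι → Fin 4 → V) (J : Finset ι) : Set V :=
  {v | ∀ i a, q i a ≠ v ∧ (i ∈ J → F i a ≠ v)}

/-- The family obtained from `q` by exchanging `q i` for `F i` when `i ∈ T`. -/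
def exchange {ι : Type*} [DecidableEq ι] (q F : ι → Fin 4 → V) (T : Finset ι) :
    ι → Fin 4 → V :=
  fun i => if i ∈ T then F i else q i

/-- Replacement quadruples `F j`, `j ∈ J`, that are disjoint from each other and from the
`q i`, `i ≠ j`, such that the spans of the independent exchanges intersect in the span of the
`q i`, `i ∉ J`. -/
structure IsExchange (K : Type*) {V M ι : Type*} [Field K] [AddCommGroup M] [Module K M]
    [DecidableEq ι] (vec : (Fin 4 → V) → M) (q F : ι → Fin 4 → V) (J : Finset ι) : Prop where
  inj : ∀ j ∈ J, Function.Injective (F j)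
  disj : ∀ j ∈ J, ∀ i ≠ j, ∀ a b, F j a ≠ q i b
  disj' : ∀ j ∈ J, ∀ i ∈ J, i ≠ j → ∀ a b, F j a ≠ F i b
  sep : ∀ v, v ∉ Submodule.span K ((fun i => vec (q i)) '' {i | i ∉ J}) →
    ∃ T ⊆ J, LinearIndependent K (fun i => vec (exchange q F T i)) ∧
      v ∉ Submodule.span K (Set.range fun i => vec (exchange q F T i))

theorem IsExchange.injective_exchange {ι : Type*} [DecidableEq ι] {vec : (Fin 4 → V) → M}
    {q F : ι → Fin 4 → V} {J T : Finset ι} (h : IsExchange K vec q F J)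
    (hq : Function.Injective (Function.uncurry q)) (hT : T ⊆ J) :
    Function.Injective (Function.uncurry (exchange q F T)) := by
  rintro ⟨i, a⟩ ⟨j, b⟩ hij
  have hq' : ∀ i j a b, q i a = q j b → i = j ∧ a = b := fun i j a b e => by
    simpa using hq (a₁ := (i, a)) (a₂ := (j, b)) e
  simp only [Function.uncurry, exchange] at hij
  by_cases hi : i ∈ T <;> by_cases hj : j ∈ T <;> simp only [hi, hj, if_true, if_false] at hij
  · by_cases e : j = i
    · subst e
      rw [h.inj _ (hT hi) hij]
    · exact (h.disj' i (hT hi) j (hT hj) e a b hij).elim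
  · exact (h.disj i (hT hi) j (by rintro rfl; exact hj hi) a b hij).elim
  · exact (h.disj j (hT hj) i (by rintro rfl; exact hi hj) b a hij.symm).elim
  · obtain ⟨rfl, rfl⟩ := hq' _ _ _ _ hij
    rfl

/-- Otherwise some independent exchange has a span that misses `vec f`. Adding `f` to it gives a
system with one more member, since `unused` avoids both the `q i` and the replacements. -/
theorem IsExchange.vec_mem {ι : Type*} [DecidableEq ι] {vec : (Fin 4 → V) → M}
    {q F : ι → Fin 4 → V} {J : Finset ι} (h : IsExchange K vec q F J)
    (hq : IsIndepSystem K vec q) (hmax : ∀ q' : Option ι → Fin 4 → V, ¬ IsIndepSystem K vec q')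
    {f : Fin 4 → V} (hf : Function.Injective f) (hfR : ∀ a, f a ∈ unused q F J) :
    vec f ∈ Submodule.span K ((fun i => vec (q i)) '' {i | i ∉ J}) := by
  by_contra hv
  obtain ⟨T, hTJ, hT, hvT⟩ := h.sep _ hv
  refine hmax (fun o => o.elim f (exchange q F T)) ⟨?_, ?_⟩
  · have hR : ∀ i a b, exchange q F T i a ≠ f b := by
      intro i a b
      unfold exchange
      split_ifs with hi
      · exact (hfR b i a).2 (hTJ hi)
      · exact (hfR b i a).1
    rintro ⟨_ | i, a⟩ ⟨_ | j, b⟩ e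
    · simp only [Function.uncurry, Option.elim] at e
      rw [hf e]
    · exact (hR _ _ _ e.symm).elim
    · exact (hR _ _ _ e).elim
    · have := h.injective_exchange hq.1 hTJ (a₁ := (i, a)) (a₂ := (j, b)) e
      simpa using this
  · rw [linearIndependent_option]
    exact ⟨hT, hvT⟩

theorem linearIndependent_update {ι : Type*} [DecidableEq ι] {u : ι → M}
    (hu : LinearIndependent K u) {v : M} (hv : v ∉ Submodule.span K (Set.range u)) (j : ι) :
    LinearIndependent K (Function.update u j v) := by
  have h1 : LinearIndependent K (fun o : Option ι => o.elim v u) := by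
    rw [linearIndependent_option]
    exact ⟨hu, hv⟩
  have h2 := h1.comp (fun i => if i = j then none else some i) (by
    intro a b hab
    by_cases ha : a = j <;> by_cases hb : b = j <;> simp_all)
  convert h2 using 1
  funext i
  by_cases hi : i = j
  · subst hi; simp
  · simp [hi]

theorem mem_span_image_inter {ι : Type*} {u : ι → M} (hu : LinearIndependent K u) {s t : Set ι}
    {v : M} (hs : v ∈ Submodule.span K (u '' s)) (ht : v ∈ Submodule.span K (u '' t)) :
    v ∈ Submodule.span K (u '' (s ∩ t)) := by
  rw [Finsupp.mem_span_image_iff_linearCombination] at hs ht ⊢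
  obtain ⟨l₁, hl₁, rfl⟩ := hs
  obtain ⟨l₂, hl₂, h⟩ := ht
  rw [hu.finsuppLinearCombination_injective.eq_iff] at h
  subst h
  exact ⟨l₂, Set.subset_inter hl₁ hl₂, rfl⟩

/-- The engine of the argument: a quadruple whose vector escapes the span of the kept ones can serve
as a replacement for `q j`, even if it uses vertices of `q j`. This shrinks the common span by the
generator `vec (q j)`. -/
theorem IsExchange.insert_update {ι : Type*} [DecidableEq ι] {vec : (Fin 4 → V) → M}
    {q F : ι → Fin 4 → V} {J : Finset ι} (h : IsExchange K vec q F J)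
    (hq : IsIndepSystem K vec q) {j : ι} (hj : j ∉ J)
    {f : Fin 4 → V} (hf : Function.Injective f)
    (hfR : ∀ a, f a ∈ unused q F J ∨ ∃ b, f a = q j b)
    (hv : vec f ∉ Submodule.span K ((fun i => vec (q i)) '' {i | i ∉ J})) :
    IsExchange K vec q (Function.update F j f) (insert j J) := by
  have hq' : ∀ i j a b, q i a = q j b → i = j ∧ a = b := fun i j a b e => by
    simpa using hq.1 (a₁ := (i, a)) (a₂ := (j, b)) e
  have hupd : ∀ i ∈ J, Function.update F j f i = F i := fun i hi =>
    Function.update_of_ne (by rintro rfl; exact hj hi) _ _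
  have hF : ∀ i ∈ J, ∀ a b, F i a ≠ f b := by
    intro i hi a b e
    rcases hfR b with hb | ⟨b', hb⟩
    · exact (hb i a).2 hi e
    · exact h.disj i hi j (by rintro rfl; exact hj hi) a b' (e.trans hb)
  refine ⟨?_, ?_, ?_, ?_⟩
  · intro i hi
    rcases Finset.mem_insert.1 hi with rfl | hi
    · simpa using hf
    · rw [hupd i hi]; exact h.inj i hi
  · intro i hi l hl a b
    rcases Finset.mem_insert.1 hi with rfl | hi
    · simp only [Function.update_self]
      intro e
      rcases hfR a with ha | ⟨b', hb⟩
      · exact (ha l b).1 e.symm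
      · exact hl (hq' _ _ _ _ (e.symm.trans hb)).1
    · rw [hupd i hi]; exact h.disj i hi l hl a b
  · intro i hi l hl hne a b
    rcases Finset.mem_insert.1 hi with rfl | hi' <;> rcases Finset.mem_insert.1 hl with rfl | hl'
    · exact (hne rfl).elim
    · rw [hupd l hl']
      simpa using (hF l hl' b a).symm
    · rw [hupd i hi']
      simpa using hF i hi' a b
    · rw [hupd i hi', hupd l hl']
      exact h.disj' i hi' l hl' hne a b
  · intro v hvJ
    have hex : ∀ T ⊆ J, exchange q (Function.update F j f) T = exchange q F T := by
      intro T hT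
      funext i
      unfold exchange
      split_ifs with hi
      · rw [hupd i (hT hi)]
      · rfl
    by_cases hvJ' : v ∈ Submodule.span K ((fun i => vec (q i)) '' {i | i ∉ J})
    · obtain ⟨T, hTJ, hT, hfT⟩ := h.sep _ hv
      have hjT : j ∉ T := fun h => hj (hTJ h)
      have hsub : ∀ i, i ∉ J → exchange q F T i = q i := fun i hi => by
        unfold exchange
        rw [if_neg fun h => hi (hTJ h)]
      have hnew : (fun i => vec (exchange q (Function.update F j f) (insert j T) i)) =
          Function.update (fun i => vec (exchange q F T i)) j (vec f) := by
        funext i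
        by_cases hi : i = j
        · subst hi; simp [exchange]
        · rw [Function.update_of_ne hi]
          simp [exchange, hi]
      refine ⟨insert j T, Finset.insert_subset_insert _ hTJ, ?_, ?_⟩
      · rw [hnew]
        exact linearIndependent_update hT hfT j
      · rw [hnew]
        intro hmem
        apply hvJ
        set B := fun i => vec (exchange q F T i) with hB
        have hvB : v ∈ Submodule.span K (B '' {i | i ∉ J}) := by
          have : B '' {i | i ∉ J} = (fun i => vec (q i)) '' {i | i ∉ J} :=
            Set.image_congr fun i hi => by rw [hB]; simp only [hsub i hi]
          rwa [this]
        have hrange : Set.range (Function.update B j (vec f)) =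
            Insert.insert (vec f) (B '' {i | i ≠ j}) := by
          ext x
          constructor
          · rintro ⟨i, rfl⟩
            by_cases hi : i = j
            · subst hi; simp
            · right; exact ⟨i, hi, by simp [hi]⟩
          · rintro (rfl | ⟨i, hi, rfl⟩)
            · exact ⟨j, by simp⟩
            · exact ⟨i, by simp [show i ≠ j from hi]⟩
        rw [hrange, Submodule.mem_span_insert] at hmem
        obtain ⟨c, z, hz, hvz⟩ := hmem
        have hzr : z ∈ Submodule.span K (Set.range B) :=
          Submodule.span_mono (Set.image_subset_range _ _) hz
        have hvr : v ∈ Submodule.span K (Set.range B) :=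
          Submodule.span_mono (Set.image_subset_range _ _) hvB
        -- Both `v` and `z` lie in the old span and `vec f` does not, so `vec f` cannot contribute.
        -- Then `v` is spanned by two subfamilies of an independent family, hence by their
        -- intersection.
        have hc : c = 0 := by
          by_contra hc
          apply hfT
          have : c • vec f ∈ Submodule.span K (Set.range B) := by
            have := Submodule.sub_mem _ hvr hzr
            rwa [hvz, add_sub_cancel_right] at this
          exact (Submodule.smul_mem_iff _ hc).1 this
        rw [hc, zero_smul, zero_add] at hvz
        subst hvz
        refine Submodule.span_mono ?_ (mem_span_image_inter hT hz hvB)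
        rintro _ ⟨i, ⟨hi1, hi2⟩, rfl⟩
        refine ⟨i, ?_, ?_⟩
        · simp only [Set.mem_ofPred_eq] at hi1 hi2
          simp [hi1, hi2]
        · simp only [hB, hsub i hi2]
    · obtain ⟨T, hTJ, hT, hvT⟩ := h.sep _ hvJ'
      refine ⟨T, hTJ.trans (Finset.subset_insert _ _), ?_⟩
      rw [hex T hTJ]
      exact ⟨hT, hvT⟩

/-- Take `J` of maximal size among all exchanges for a maximal system: a quadruple violating the
last clause would enlarge `J` by `insert_update`. -/
theorem exists_closed_exchange [FiniteDimensional K M] (vec : (Fin 4 → V) → M) :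
    ∃ d ≤ Module.finrank K M, ∃ q F : Fin d → Fin 4 → V, ∃ J : Finset (Fin d),
      Function.Injective (Function.uncurry q) ∧
      (∀ f : Fin 4 → V, Function.Injective f → (∀ a, f a ∈ unused q F J) →
        vec f ∈ Submodule.span K ((fun i => vec (q i)) '' {i | i ∉ J})) ∧
      ∀ j ∉ J, ∀ f : Fin 4 → V, Function.Injective f →
        (∀ a, f a ∈ unused q F J ∨ ∃ b, f a = q j b) →
        vec f ∈ Submodule.span K ((fun i => vec (q i)) '' {i | i ∉ J}) := by
  classical
  obtain ⟨d, hd, q, hq, hmax⟩ := exists_maximal_indepSystem (K := K) vec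
  let S : Finset (Finset (Fin d)) := {J | ∃ F, IsExchange K vec q F J}
  have hS : S.Nonempty := by
    refine ⟨∅, ?_⟩
    simp only [S, Finset.mem_filter, Finset.mem_univ, true_and]
    refine ⟨q, by simp, by simp, by simp, fun v hv => ⟨∅, subset_rfl, ?_, ?_⟩⟩
    · simpa [exchange] using hq.2
    · simpa [exchange] using hv
  obtain ⟨J, hJS, hJ⟩ := S.exists_max_image Finset.card hS
  obtain ⟨F, hF⟩ : ∃ F, IsExchange K vec q F J := by simpa [S] using hJS
  refine ⟨d, hd, q, F, J, hq.1, fun f hf hfR => hF.vec_mem hq hmax hf hfR,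
    fun j hj f hf hfR => ?_⟩
  by_contra hv
  have := hJ (insert j J) (by
    simp only [S, Finset.mem_filter, Finset.mem_univ, true_and]
    exact ⟨_, hF.insert_update hq hj hf hfR hv⟩)
  rw [Finset.card_insert_of_notMem hj] at this
  omega

end Exchange

/-! ### Paths with switchable blocks. -/

section Blocks

variable {V : Type*} {r : ℕ}

/-- The indicator vector modulo `2` of the colour of the edge `xy`. -/
def edgeVec (c : V → V → Fin r) (x y : V) : Fin r → ZMod 2 :=
  Pi.single (c x y) 1

/-- The vector of colour parities of the path through the vertices of a list. -/
def pathVec (c : V → V → Fin r) : List V → Fin r → ZMod 2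
  | [] => 0
  | [_] => 0
  | a :: b :: l => edgeVec c a b + pathVec c (b :: l)

theorem two_eq_zero : (2 : Fin r → ZMod 2) = 0 := by
  funext i
  exact CharTwo.two_eq_zero

theorem edgeVec_comm {c : V → V → Fin r} (hc : ∀ x y, c x y = c y x) (x y : V) :
    edgeVec c x y = edgeVec c y x := by
  rw [edgeVec, hc, edgeVec]

theorem pathVec_append_cons (c : V → V → Fin r) (l : List V) (a : V) (l' : List V) :
    pathVec c (l ++ a :: l') = pathVec c (l ++ [a]) + pathVec c (a :: l') := by
  induction l with
  | nil => simp [pathVec]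
  | cons b l ih =>
    cases l with
    | nil => simp [pathVec]
    | cons d l => simpa [pathVec, add_assoc] using ih

/-- A list of vertices `s` with a rearrangement `s'` such that running through `s'` in place of `s`
changes the parity vector by `u`. -/
structure Block (c : V → V → Fin r) where
  /-- The basic order. -/
  s : List V
  /-- The alternative order. -/
  s' : List V
  /-- The change of the parity vector. -/
  u : Fin r → ZMod 2
  perm : s'.Perm s
  pathVec_eq : ∀ x y, pathVec c (x :: (s' ++ [y])) = pathVec c (x :: (s ++ [y])) + u

/-- The span of the changes that the blocks of a list offer. -/
def flipSpan {c : V → V → Fin r} (L : List (Block c)) : Submodule (ZMod 2) (Fin r → ZMod 2) :=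
  Submodule.span (ZMod 2) {m | ∃ b ∈ L, b.u = m}

/-- Modulo `U`, a path from `x ∈ P` through `s` to `y ∈ P` looks as if each edge `ab` had
the vector `g a + g b + k`. -/
def Neutral (c : V → V → Fin r) (g : V → Fin r → ZMod 2) (k : Fin r → ZMod 2)
    (U : Submodule (ZMod 2) (Fin r → ZMod 2)) (P s : List V) : Prop :=
  ∀ x ∈ P, ∀ y ∈ P, x ≠ y →
    pathVec c (x :: (s ++ [y])) + g x + g y + (s.length + 1 : ℕ) * k ∈ U

theorem Neutral.mono {c : V → V → Fin r} {g : V → Fin r → ZMod 2} {k : Fin r → ZMod 2}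
    {U U' : Submodule (ZMod 2) (Fin r → ZMod 2)} {P P' s : List V} (h : Neutral c g k U P s)
    (hU : U ≤ U') (hP : P' ⊆ P) : Neutral c g k U' P' s :=
  fun x hx y hy hxy => hU (h x (hP hx) y (hP hy) hxy)

/-- Put the lists of `S` between the vertices of `P`. -/
def weave : List (List V) → List V → List V
  | [], P => P
  | _ :: _, [] => []
  | s :: S, x :: P => x :: (s ++ weave S P)

theorem weave_perm : ∀ (S : List (List V)) (P : List V), S.length ≤ P.length →
    (weave S P).Perm (S.flatten ++ P)
  | [], P, _ => by simp [weave]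
  | _ :: _, [], h => by simp at h
  | s :: S, x :: P, h => by
    have ih := weave_perm S P (by simpa using h)
    simp only [weave, List.flatten_cons, List.append_assoc]
    refine (List.Perm.cons x (ih.append_left s)).trans ?_
    rw [← List.append_assoc, ← List.append_assoc]
    exact List.perm_middle.symm

theorem head?_weave : ∀ (S : List (List V)) (P : List V), S.length ≤ P.length →
    (weave S P).head? = P.head?
  | [], P, _ => rfl
  | _ :: _, [], h => by simp at h
  | s :: S, x :: P, h => rfl

/-- Every pool vertex inside the tour meets two segments, so its potential occurs twice and cancels
modulo `2`. -/
theorem pathVec_weave_mem {c : V → V → Fin r} {g : V → Fin r → ZMod 2} {k : Fin r → ZMod 2}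
    {U : Submodule (ZMod 2) (Fin r → ZMod 2)} {Q : List V} (y : V) (hy : y ∈ Q)
    (hgood : ∀ x ∈ Q, ∀ y ∈ Q, x ≠ y → edgeVec c x y + g x + g y + k ∈ U) :
    ∀ (P : List V) (x : V) (S : List (List V)), S.length ≤ P.length + 1 → x ∈ Q → P ⊆ Q →
      (x :: (P ++ [y])).IsChain (· ≠ ·) → (∀ s ∈ S, Neutral c g k U Q s) →
      pathVec c (weave S (x :: P) ++ [y]) + g x + g y + (weave S (x :: P)).length * k ∈ U
  | [], x, [], _, hx, _, hch, _ => by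
    have := hgood x hx y hy (by simpa using hch)
    simpa [weave, pathVec] using this
  | [], x, [s], _, hx, _, hch, hS => by
    have := hS s (by simp) x hx y hy (by simpa using hch)
    simpa [weave] using this
  | [], x, s :: t :: S, h, _, _, _, _ => by simp at h
  | z :: P, x, [], _, hx, hP, hch, hS => by
    have hz : z ∈ Q := hP (by simp)
    simp only [List.cons_append, List.isChain_cons_cons] at hch
    have h1 := hgood x hx z hz hch.1
    have h2 := pathVec_weave_mem y hy hgood P z [] (by simp) hz
      (fun a ha => hP (by simp [ha])) hch.2 (by simp)
    have h3 := U.add_mem h1 h2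
    simp only [weave, List.cons_append, pathVec, List.length_cons] at h2 h3 ⊢
    convert h3 using 1
    push_cast
    linear_combination (-g z) * two_eq_zero (r := r)
  | z :: P, x, s :: S, hlen, hx, hP, hch, hS => by
    have hz : z ∈ Q := hP (by simp)
    simp only [List.cons_append, List.isChain_cons_cons] at hch
    have hlen' : S.length ≤ P.length + 1 := by simpa using hlen
    have h1 := hS s (by simp) x hx z hz hch.1
    have h2 := pathVec_weave_mem y hy hgood P z S hlen' hz
      (fun a ha => hP (by simp [ha])) hch.2 (fun t ht => hS t (by simp [ht]))
    have h3 := U.add_mem h1 h2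
    obtain ⟨l, hl⟩ : ∃ l, weave S (z :: P) = z :: l := by
      have := head?_weave S (z :: P) (by simpa using hlen')
      simpa [List.head?_eq_some_iff] using this
    have h4 := pathVec_append_cons c (x :: s) z (l ++ [y])
    simp only [weave, hl, List.cons_append, List.length_cons, List.length_append,
      List.append_assoc] at h3 h4 ⊢
    rw [h4]
    convert h3 using 1
    push_cast
    linear_combination (-g z) * two_eq_zero (r := r)

theorem flipSpan_cons {c : V → V → Fin r} (b : Block c) (L : List (Block c)) :
    flipSpan (b :: L) = Submodule.span (ZMod 2) {b.u} ⊔ flipSpan L := by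
  rw [flipSpan, flipSpan, ← Submodule.span_union]
  congr 1
  ext m
  simp [eq_comm]

/-- Each block can be flipped independently because its flanking vertices stay in place;
preservation of the head is what carries this through the induction. -/
theorem exists_flips {c : V → V → Fin r} (y : V) : ∀ (L : List (Block c)) (P : List V),
    L.length ≤ P.length → ∀ v ∈ flipSpan L, ∃ l : List V,
      l.Perm (weave (L.map Block.s) P) ∧ l.head? = P.head? ∧
      pathVec c (l ++ [y]) = pathVec c (weave (L.map Block.s) P ++ [y]) + v
  | [], P, _, v, hv => by
    have : v = 0 := by simpa [flipSpan] using hv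
    subst this
    exact ⟨P, by simp [weave]⟩
  | _ :: _, [], h, _, _ => by simp at h
  | b :: L, x :: P, h, v, hv => by
    rw [flipSpan_cons, Submodule.mem_sup] at hv
    obtain ⟨u, hu, v', hv', rfl⟩ := hv
    have hlen : L.length ≤ P.length := by simpa using h
    obtain ⟨l, hl1, hl2, hl3⟩ := exists_flips y L P hlen v' hv'
    -- `z` is the vertex following the block: the next pool vertex, or the end `y` when the pool is
    -- exhausted.
    have hz : ∃ z t t', l ++ [y] = z :: t ∧ weave (L.map Block.s) P ++ [y] = z :: t' := by
      have h1 := head?_weave (L.map Block.s) P (by simpa using hlen)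
      cases P with
      | nil =>
        simp only [List.head?_nil, List.head?_eq_none_iff] at h1 hl2
        exact ⟨y, [], [], by simp [hl2], by simp [h1]⟩
      | cons z P =>
        simp only [List.head?_cons, List.head?_eq_some_iff] at h1 hl2
        obtain ⟨t, ht⟩ := hl2
        obtain ⟨t', ht'⟩ := h1
        exact ⟨z, t ++ [y], t' ++ [y], by simp [ht], by simp [ht']⟩
    obtain ⟨z, t, t', hzt, hzt'⟩ := hz
    have key : ∀ s w, pathVec c (x :: (s ++ [z])) = pathVec c (x :: (b.s ++ [z])) + w →
        pathVec c (x :: (s ++ l) ++ [y]) =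
          pathVec c (weave ((b :: L).map Block.s) (x :: P) ++ [y]) + (w + v') := by
      intro s w hw
      have e1 := pathVec_append_cons c (x :: s) z t
      have e2 := pathVec_append_cons c (x :: b.s) z t'
      simp only [List.map_cons, weave, List.cons_append, List.append_assoc, hzt, hzt'] at e1 e2 hl3 ⊢
      rw [e1, e2, hl3, hw]
      abel
    obtain ⟨a, rfl⟩ := Submodule.mem_span_singleton.1 hu
    have ha : a = 0 ∨ a = 1 := (by decide : ∀ a : ZMod 2, a = 0 ∨ a = 1) a
    rcases ha with rfl | rfl
    · refine ⟨x :: (b.s ++ l), ?_, rfl, ?_⟩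
      · simpa [weave] using hl1.append_left b.s
      · rw [key b.s 0 (by simp), zero_smul]
    · refine ⟨x :: (b.s' ++ l), ?_, rfl, ?_⟩
      · simpa [weave] using b.perm.append hl1
      · rw [key b.s' b.u (b.pathVec_eq x z), one_smul]

end Blocks

/-! ### Absorbing the exceptional vertices. -/

section Layout

variable {V : Type*} {r : ℕ}

/-- The blocks of `L` and the pool `P` partition the vertex set, all edges inside the pool look like
`g x + g y + k` modulo the flips, and so do the blocks except perhaps some of the singletons. -/
structure IsLayout [Fintype V] (c : V → V → Fin r) (g : V → Fin r → ZMod 2)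
    (k : Fin r → ZMod 2) (L : List (Block c)) (P : List V) : Prop where
  perm : (L.flatMap Block.s ++ P).Perm Finset.univ.toList
  good : ∀ x ∈ P, ∀ y ∈ P, x ≠ y → edgeVec c x y + g x + g y + k ∈ flipSpan L
  block : ∀ b ∈ L, Neutral c g k (flipSpan L) P b.s ∨ ∃ w, b.s = [w]

theorem IsLayout.nodup [Fintype V] {c : V → V → Fin r} {g : V → Fin r → ZMod 2}
    {k : Fin r → ZMod 2} {L : List (Block c)} {P : List V} (h : IsLayout c g k L P) :
    (L.flatMap Block.s ++ P).Nodup :=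
  h.perm.nodup_iff.2 (Finset.nodup_toList _)

theorem Block.u_eq_zero {c : V → V → Fin r} (b : Block c) {w : V} (hb : b.s = [w]) : b.u = 0 := by
  have h1 : b.s' = [w] := List.perm_singleton.1 (hb ▸ b.perm)
  have h2 := b.pathVec_eq w w
  rw [h1, hb] at h2
  simpa using h2

/-- The block `p a b d e` in which `b` and `d` may be swapped. -/
def swapBlock {c : V → V → Fin r} (hc : ∀ x y, c x y = c y x) (p : List V) (a b d e : V) :
    Block c where
  s := p ++ [a, b, d, e]
  s' := p ++ [a, d, b, e]
  u := edgeVec c a b + edgeVec c d e + edgeVec c a d + edgeVec c b e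
  perm := ((List.Perm.swap b d [e]).cons a).append_left p
  pathVec_eq x y := by
    have e1 := pathVec_append_cons c (x :: p) a [b, d, e, y]
    have e2 := pathVec_append_cons c (x :: p) a [d, b, e, y]
    simp only [List.cons_append, List.append_assoc, List.nil_append] at e1 e2 ⊢
    rw [e1, e2]
    simp only [pathVec, edgeVec_comm hc d b]
    linear_combination (-edgeVec c a b - edgeVec c d e) * two_eq_zero (r := r)

/-- Pigeonhole on the pairs `(c w v, φ v)`: outside `x` and `y` there remain at least `r ^ 2 + 1`
vertices for `r ^ 2` boxes. The repeated value differs modulo `U` from that of `x` or of `y`; that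
one takes the role of `y` and the other becomes `z`. -/
theorem exists_pair_of_not_mem [DecidableEq V] {c : V → V → Fin r} {g : V → Fin r → ZMod 2}
    {φ : V → Fin r} (hφ : ∀ x y, φ x = φ y → g x = g y)
    {U : Submodule (ZMod 2) (Fin r → ZMod 2)} {P : List V} (hnd : P.Nodup)
    (hP : r ^ 2 + 3 ≤ P.length) {w x y : V} (hx : x ∈ P) (hy : y ∈ P) (hxy : x ≠ y)
    (h : edgeVec c w x + g x + (edgeVec c w y + g y) ∉ U) :
    ∃ x₁ x₂ y z, ∃ P', P.Perm (x₁ :: x₂ :: y :: z :: P') ∧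
      edgeVec c w x₁ = edgeVec c w x₂ ∧ g x₁ = g x₂ ∧
      edgeVec c w x₂ + g x₂ + (edgeVec c w y + g y) ∉ U := by
  have hxy' : y ∈ P.erase x := (List.mem_erase_of_ne hxy.symm).2 hy
  have p1 : P.Perm (x :: y :: (P.erase x).erase y) :=
    (List.perm_cons_erase hx).trans ((List.perm_cons_erase hxy').cons x)
  set Q := (P.erase x).erase y with hQ
  have hlen : P.length = Q.length + 2 := by simpa using p1.length_eq
  have hnd' : (x :: y :: Q).Nodup := p1.nodup_iff.1 hnd
  have hQn : Q.Nodup := by simp only [List.nodup_cons] at hnd'; exact hnd'.2.2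
  obtain ⟨x₁, hx₁, x₂, hx₂, hne, heq⟩ := Finset.exists_ne_map_eq_of_card_lt_of_maps_to
    (s := Q.toFinset) (t := (Finset.univ : Finset (Fin r × Fin r)))
    (f := fun v => (c w v, φ v)) (by
      rw [List.toFinset_card_of_nodup hQn, Finset.card_univ]
      simp only [Fintype.card_prod, Fintype.card_fin]
      nlinarith) (fun _ _ => Finset.mem_coe.2 (Finset.mem_univ _))
  simp only [Prod.mk.injEq] at heq
  rw [List.mem_toFinset] at hx₁ hx₂
  have hx₂' : x₂ ∈ Q.erase x₁ := (List.mem_erase_of_ne hne.symm).2 hx₂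
  have p2 : Q.Perm (x₁ :: x₂ :: (Q.erase x₁).erase x₂) :=
    (List.perm_cons_erase hx₁).trans ((List.perm_cons_erase hx₂').cons x₁)
  have p3 : P.Perm (x₁ :: x₂ :: x :: y :: (Q.erase x₁).erase x₂) :=
    p1.trans (((p2.cons y).cons x).trans
      (List.perm_append_comm (l₁ := [x, y]) (l₂ := [x₁, x₂]) |>.append_right _))
  have hc1 : edgeVec c w x₁ = edgeVec c w x₂ := by rw [edgeVec, heq.1, edgeVec]
  by_cases hU : edgeVec c w x₂ + g x₂ + (edgeVec c w y + g y) ∈ U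
  · refine ⟨x₁, x₂, x, y, _, p3, hc1, hφ _ _ heq.2, fun hU' => h ?_⟩
    convert U.add_mem hU hU' using 1
    linear_combination (-edgeVec c w x₂ - g x₂) * two_eq_zero (r := r)
  · exact ⟨x₁, x₂, y, x, _, p3.trans (((List.Perm.swap _ _ _).cons _).cons _), hc1,
      hφ _ _ heq.2, hU⟩

/-- Induction on a bound `m` for the codimension of `flipSpan L`. A singleton `w` that is not
neutral is merged with four pool vertices into a swap block that raises the dimension and leaves the
number of blocks unchanged. -/
theorem IsLayout.exists_neutral [Fintype V] [DecidableEq V] {c : V → V → Fin r}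
    (hc : ∀ x y, c x y = c y x) {g : V → Fin r → ZMod 2} {φ : V → Fin r}
    (hφ : ∀ x y, φ x = φ y → g x = g y) {k : Fin r → ZMod 2} :
    ∀ (m : ℕ) (L : List (Block c)) (P : List V),
      r ≤ Module.finrank (ZMod 2) (flipSpan L) + m → IsLayout c g k L P →
      r ^ 2 + 3 + 4 * m ≤ P.length →
      ∃ L' P', L'.length = L.length ∧ P.length ≤ P'.length + 4 * m ∧ IsLayout c g k L' P' ∧
        ∀ b ∈ L', Neutral c g k (flipSpan L') P' b.s := by
  intro m
  induction m with
  | zero =>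
    intro L P hr hL _
    have htop : flipSpan L = ⊤ := Submodule.eq_top_of_finrank_eq
      (le_antisymm (Submodule.finrank_le _) (by simpa using hr))
    refine ⟨L, P, rfl, by simp, hL, fun b _ x _ y _ _ => ?_⟩
    rw [htop]
    trivial
  | succ m ih =>
    intro L P hr hL hP
    by_cases hall : ∀ b ∈ L, Neutral c g k (flipSpan L) P b.s
    · exact ⟨L, P, rfl, by omega, hL, hall⟩
    push Not at hall
    obtain ⟨b, hb, hbn⟩ := hall
    obtain ⟨w, hw⟩ := (hL.block b hb).resolve_left hbn
    unfold Neutral at hbn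
    push Not at hbn
    obtain ⟨x, hx, y, hy, hxy, hn⟩ := hbn
    have hn' : edgeVec c w x + g x + (edgeVec c w y + g y) ∉ flipSpan L := by
      intro h
      apply hn
      convert h using 1
      simp only [hw, List.cons_append, List.nil_append, pathVec, List.length_singleton,
        edgeVec_comm hc x w]
      push_cast
      linear_combination k * two_eq_zero (r := r)
    have hnd : P.Nodup := hL.nodup.of_append_right
    obtain ⟨x₁, x₂, y, z, P', hperm, he, hg, hu⟩ :=
      exists_pair_of_not_mem hφ hnd (by omega) hx hy hxy hn'
    obtain ⟨L', hL'⟩ : ∃ L', L.Perm (b :: L') := by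
      obtain ⟨L₁, L₂, rfl⟩ := List.append_of_mem hb
      exact ⟨L₁ ++ L₂, List.perm_middle⟩
    have hmem : ∀ v ∈ [x₁, x₂, y, z], v ∈ P := fun v hv => hperm.mem_iff.2 (by
      simp only [List.mem_cons, List.not_mem_nil, or_false] at hv ⊢
      tauto)
    have hnd4 : (x₁ :: x₂ :: y :: z :: P').Nodup := hperm.nodup_iff.1 hnd
    have hP'P : P' ⊆ P := fun v hv => hperm.mem_iff.2 (by simp [hv])
    -- The order is `x₁ w x₂ y z` with `x₂`, `y` swappable. The edges `x₁w` and `wx₂` have equal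
    -- vectors and cancel, as do `g x₁` and `g x₂`, so the block is neutral although `w` is not.
    set B : Block c := swapBlock hc [x₁] w x₂ y z with hB
    have hle : flipSpan L ≤ flipSpan (B :: L') := by
      refine Submodule.span_le.2 ?_
      rintro _ ⟨b', hb', rfl⟩
      rcases List.mem_cons.1 (hL'.mem_iff.1 hb') with rfl | hb'
      · rw [b'.u_eq_zero hw]
        exact Submodule.zero_mem _
      · exact Submodule.subset_span ⟨b', by simp [hb'], rfl⟩
    have hBu : B.u ∈ flipSpan (B :: L') := Submodule.subset_span ⟨B, by simp, rfl⟩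
    have hyz : y ≠ z := by simp at hnd4; tauto
    have hx₂z : x₂ ≠ z := by simp at hnd4; tauto
    have hx₂y : x₂ ≠ y := by simp at hnd4; tauto
    have g1 := hL.good y (hmem _ (by simp)) z (hmem _ (by simp)) hyz
    have g2 := hL.good x₂ (hmem _ (by simp)) z (hmem _ (by simp)) hx₂z
    have g3 := hL.good x₂ (hmem _ (by simp)) y (hmem _ (by simp)) hx₂y
    -- Replacing `yz` and `x₂z` by their potentials turns `B.u` into the discrepancy of `w` between
    -- `x₂` and `y`, which lies outside the span.
    have hBn : B.u ∉ flipSpan L := by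
      intro h
      apply hu
      convert (flipSpan L).add_mem h ((flipSpan L).add_mem g1 g2) using 1
      simp only [hB, swapBlock]
      linear_combination (-edgeVec c y z - edgeVec c x₂ z - g z - k) * two_eq_zero (r := r)
    have hlt : flipSpan L < flipSpan (B :: L') :=
      lt_of_le_of_ne hle fun e => hBn (e ▸ hBu)
    have hfin := Submodule.finrank_lt_finrank_of_lt hlt
    have hPlen : P.length = P'.length + 4 := by simpa using hperm.length_eq
    have hlay : IsLayout c g k (B :: L') P' := by
      refine ⟨?_, fun x hx y hy hxy => hle (hL.good x (hP'P hx) y (hP'P hy) hxy), ?_⟩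
      · refine List.Perm.trans ?_ hL.perm
        have e1 : (L.flatMap Block.s).Perm (w :: L'.flatMap Block.s) := by
          simpa [hw] using hL'.flatMap_right Block.s
        refine List.Perm.trans ?_ (e1.append hperm).symm
        classical
        rw [List.perm_iff_count]
        intro v
        simp only [hB, swapBlock, List.flatMap_cons, List.count_append, List.count_cons,
          List.count_nil]
        omega
      · intro b' hb'
        rcases List.mem_cons.1 hb' with rfl | hb'
        · left
          intro a ha d hd had
          have ha1 : a ≠ x₁ := by rintro rfl; simp [ha] at hnd4
          have hdz : z ≠ d := by rintro rfl; simp [hd] at hnd4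
          have g4 := hL.good a (hP'P ha) x₁ (hmem _ (by simp)) ha1
          have g5 := hL.good z (hmem _ (by simp)) d (hP'P hd) hdz
          refine hle ?_
          convert (flipSpan L).add_mem ((flipSpan L).add_mem g1 g3)
            ((flipSpan L).add_mem g4 g5) using 1
          simp only [hB, swapBlock, List.cons_append, List.nil_append, pathVec, List.length_cons,
            List.length_nil, edgeVec_comm hc x₁ w, he, hg]
          push_cast
          linear_combination (edgeVec c w x₂ + k - g x₂ - g y - g z) * two_eq_zero (r := r)
        · exact (hL.block b' (hL'.mem_iff.2 (by simp [hb']))).imp_left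
            fun h => h.mono hle hP'P
    obtain ⟨L'', P'', h1, h2, h3, h4⟩ := ih (B :: L') P' (by omega) hlay (by omega)
    refine ⟨L'', P'', ?_, by omega, h3, h4⟩
    rw [h1, hL'.length_eq]
    rfl

theorem IsLayout.exists_cyclic_list [Fintype V] {c : V → V → Fin r} {g : V → Fin r → ZMod 2}
    {k : Fin r → ZMod 2} {L : List (Block c)} {P : List V} (h : IsLayout c g k L P)
    (hn : ∀ b ∈ L, Neutral c g k (flipSpan L) P b.s) (hlen : L.length ≤ P.length)
    (hP : 2 ≤ P.length) :
    ∃ (x : V) (l : List V), (x :: l).Perm Finset.univ.toList ∧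
      pathVec c (x :: l ++ [x]) = (Fintype.card V : Fin r → ZMod 2) * k := by
  obtain ⟨x, P', rfl⟩ : ∃ x P', P = x :: P' := by
    cases P with
    | nil => simp at hP
    | cons x P' => exact ⟨x, P', rfl⟩
  have hnd : (x :: P').Nodup := h.nodup.of_append_right
  have hch : (x :: (P' ++ [x])).IsChain (· ≠ ·) := by
    rw [← List.cons_append, List.isChain_append]
    refine ⟨hnd.isChain, by simp, ?_⟩
    intro a ha b hb
    simp only [List.head?_cons, Option.mem_some_iff] at hb
    subst hb
    rintro rfl
    have hP' : P' ≠ [] := by rintro rfl; simp at hP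
    rw [List.getLast?_cons_of_ne_nil hP'] at ha
    exact (List.nodup_cons.1 hnd).1 (List.mem_of_mem_getLast? ha)
  set W := weave (L.map Block.s) (x :: P') with hW
  have hWp : W.Perm Finset.univ.toList := by
    refine (weave_perm _ _ (by simpa using hlen)).trans ?_
    simpa [List.flatMap] using h.perm
  have hbase := pathVec_weave_mem x (by simp) h.good P' x (L.map Block.s) (by simpa using hlen)
    (by simp) (by simp) hch (by simpa using hn)
  rw [← hW, hWp.length_eq, Finset.length_toList, Finset.card_univ] at hbase
  have hv : pathVec c (W ++ [x]) + (Fintype.card V : Fin r → ZMod 2) * k ∈ flipSpan L := by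
    convert hbase using 1
    linear_combination (-g x) * two_eq_zero (r := r)
  obtain ⟨l, hl1, hl2, hl3⟩ := exists_flips x L (x :: P') hlen _ hv
  simp only [List.head?_cons, List.head?_eq_some_iff] at hl2
  obtain ⟨l', rfl⟩ := hl2
  refine ⟨x, l', hl1.trans hWp, ?_⟩
  rw [hl3, ← hW]
  linear_combination (pathVec c (W ++ [x])) * two_eq_zero (r := r)

end Layout

/-! ### From vanishing 4-cycles to a potential, and the initial layout. -/

section Core

variable {V : Type*} {r : ℕ}

/-- The sum of the edge vectors of the `4`-cycle `f 0`, `f 1`, `f 3`, `f 2`. -/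
def quadVec (c : V → V → Fin r) (f : Fin 4 → V) : Fin r → ZMod 2 :=
  edgeVec c (f 0) (f 1) + edgeVec c (f 2) (f 3) + edgeVec c (f 0) (f 2) + edgeVec c (f 1) (f 3)

/-- The 4-cycles through `p` show that `vw + wp` modulo `U` does not depend on `w`; comparing with
`w = x` and using that `xp` and `yp` have one colour identifies the constant as the vector of `xy`.
Its two copies inside the potentials cancel modulo `2`. -/
theorem edgeVec_add_mem_of_quadVec_mem {c : V → V → Fin r} (hc : ∀ x y, c x y = c y x)
    {U : Submodule (ZMod 2) (Fin r → ZMod 2)} {S : Set V}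
    (hS : ∀ f : Fin 4 → V, Function.Injective f → (∀ a, f a ∈ S) → quadVec c f ∈ U)
    {p x y : V} (hp : p ∈ S) (hx : x ∈ S) (hy : y ∈ S) (hxy : x ≠ y) (hxp : x ≠ p) (hyp : y ≠ p)
    (hcol : c x p = c y p) {v w : V} (hv : v ∈ S) (hw : w ∈ S) (hvw : v ≠ w) (hvp : v ≠ p)
    (hwp : w ≠ p) :
    edgeVec c v w + (edgeVec c v p + edgeVec c x y) + (edgeVec c w p + edgeVec c x y)
      + edgeVec c x y ∈ U := by
  have h2 := two_eq_zero (r := r)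
  have step : ∀ v w w', v ∈ S → w ∈ S → w' ∈ S → v ≠ w → v ≠ w' → w ≠ w' → v ≠ p → w ≠ p →
      w' ≠ p → edgeVec c v w + edgeVec c w' p + edgeVec c v w' + edgeVec c w p ∈ U := by
    intro v w w' hv hw hw' h1 h2 h3 h4 h5 h6
    refine hS ![v, w, w', p] ?_ ?_
    · intro a b hab
      fin_cases a <;> fin_cases b <;> simp_all
    · intro a
      fin_cases a <;> assumption
  have hcol' : edgeVec c x p = edgeVec c y p := by rw [edgeVec, hcol, edgeVec]
  have base : ∀ w, w ∈ S → x ≠ w → w ≠ p →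
      edgeVec c x w + edgeVec c x p + edgeVec c w p + edgeVec c x y ∈ U := by
    intro w hw hxw hwp
    by_cases hwy : w = y
    · subst hwy
      convert U.zero_mem using 1
      linear_combination (edgeVec c x w + edgeVec c w p) * h2 + hcol'
    · convert step x w y hx hw hy hxw hxy hwy hxp hwp hyp using 1
      linear_combination hcol'
  by_cases hvx : v = x
  · subst hvx
    convert base w hw hvw hwp using 1
    linear_combination (edgeVec c v y) * h2
  by_cases hwx : w = x
  · subst hwx
    convert base v hv (Ne.symm hvx) hvp using 1
    rw [edgeVec_comm hc v w]
    linear_combination (edgeVec c w y) * h2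
  · convert U.add_mem (step v w x hv hw hx hvw hvx hwx hvp hwp hxp)
      (base v hv (Ne.symm hvx) hvp) using 1
    rw [edgeVec_comm hc v x]
    linear_combination (edgeVec c x y - edgeVec c x v - edgeVec c x p) * h2

/-- The block consisting of one vertex. -/
def singleBlock (c : V → V → Fin r) (w : V) : Block c where
  s := [w]
  s' := [w]
  u := 0
  perm := List.Perm.refl _
  pathVec_eq _ _ := by simp

theorem nodup_flatMap_swapBlock {c : V → V → Fin r} (hc : ∀ x y, c x y = c y x) {ι : Type*}
    {q : ι → Fin 4 → V} (hq : Function.Injective (Function.uncurry q)) (I : Finset ι) :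
    ((I.toList.map fun j => swapBlock hc [] (q j 0) (q j 1) (q j 2) (q j 3)).flatMap
      Block.s).Nodup := by
  have hq' : ∀ i j a b, q i a = q j b → i = j ∧ a = b := fun i j a b e => by
    simpa using hq (a₁ := (i, a)) (a₂ := (j, b)) e
  rw [List.flatMap_map, List.nodup_flatMap]
  constructor
  · intro j _
    have hne : ∀ a b, a ≠ b → q j a ≠ q j b := fun a b h e => h (hq' j j a b e).2
    simp [swapBlock, hne]
  · refine (I.nodup_toList).imp ?_
    intro i j hij v hi hj
    have hmem : ∀ j, v ∈ (swapBlock hc [] (q j 0) (q j 1) (q j 2) (q j 3)).s → ∃ a, v = q j a := by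
      intro j h
      simp only [swapBlock, List.nil_append, List.mem_cons, List.not_mem_nil, or_false] at h
      rcases h with h | h | h | h <;> exact ⟨_, h⟩
    obtain ⟨a, ha⟩ := hmem i hi
    obtain ⟨b, hb⟩ := hmem j hj
    exact hij (hq' i j a b (ha.symm.trans hb)).1

theorem mem_flatMap_swapBlock {c : V → V → Fin r} (hc : ∀ x y, c x y = c y x) {ι : Type*}
    {q : ι → Fin 4 → V} (I : Finset ι) (v : V) :
    v ∈ (I.toList.map fun j => swapBlock hc [] (q j 0) (q j 1) (q j 2) (q j 3)).flatMap Block.s ↔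
      ∃ j ∈ I, ∃ a, q j a = v := by
  simp only [List.flatMap_map, List.mem_flatMap, Finset.mem_toList]
  refine exists_congr fun j => and_congr_right fun _ => ?_
  simp [swapBlock, Fin.exists_fin_succ, eq_comm]

theorem flatMap_singleBlock (c : V → V → Fin r) (l : List V) :
    (l.map (singleBlock c)).flatMap Block.s = l := by
  rw [List.flatMap_map]
  simp [singleBlock]

theorem card_unused [Fintype V] {d : ℕ} (q F : Fin d → Fin 4 → V) (J : Finset (Fin d))
    [DecidablePred (· ∈ unused q F J)] :
    Fintype.card V ≤ (Finset.univ.filter (· ∈ unused q F J)).card + 8 * d := by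
  classical
  have hsub : (Finset.univ : Finset V) ⊆ Finset.univ.filter (· ∈ unused q F J) ∪
      (Finset.univ.image (Function.uncurry q) ∪ Finset.univ.image (Function.uncurry F)) := by
    intro v _
    by_cases hv : v ∈ unused q F J
    · exact Finset.mem_union_left _ (Finset.mem_filter.2 ⟨Finset.mem_univ _, hv⟩)
    · refine Finset.mem_union_right _ ?_
      simp only [Finset.mem_union, Finset.mem_image, Finset.mem_univ, true_and, Prod.exists,
        Function.uncurry]
      by_contra! h
      exact hv fun i a => ⟨h.1 i a, fun _ => h.2 i a⟩
  have h1 := Finset.card_le_card hsub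
  have h2 := Finset.card_union_le (Finset.univ.filter (· ∈ unused q F J))
    (Finset.univ.image (Function.uncurry q) ∪ Finset.univ.image (Function.uncurry F))
  have h3 := Finset.card_union_le (Finset.univ.image (Function.uncurry q))
    (Finset.univ.image (Function.uncurry F))
  have h4 := Finset.card_image_le (s := Finset.univ) (f := Function.uncurry q)
  have h5 := Finset.card_image_le (s := Finset.univ) (f := Function.uncurry F)
  simp only [Finset.card_univ, Fintype.card_prod, Fintype.card_fin] at h1 h4 h5
  omega

/-- A colouring of the edges of a large complete graph has a layout with few blocks. -/
theorem exists_isLayout [Fintype V] {c : V → V → Fin r} (hc : ∀ x y, c x y = c y x)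
    (hn : 9 * r + 2 ≤ Fintype.card V) :
    ∃ (p : V) (i : Fin r) (L : List (Block c)) (P : List V),
      IsLayout c (fun v => edgeVec c v p + Pi.single i 1) (Pi.single i 1) L P ∧
      L.length ≤ 9 * r + 1 ∧ Fintype.card V ≤ P.length + 8 * r + 1 := by
  classical
  obtain ⟨d, hd, q, F, J, hq, hR, hRq⟩ := exists_closed_exchange (K := ZMod 2) (quadVec c)
  rw [Module.finrank_fin_fun] at hd
  have hq' : ∀ i j a b, q i a = q j b → i = j ∧ a = b := fun i j a b e => by
    simpa using hq (a₁ := (i, a)) (a₂ := (j, b)) e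
  set U := Submodule.span (ZMod 2) ((fun i => quadVec c (q i)) '' {i | i ∉ J}) with hU
  set R : Finset V := Finset.univ.filter (· ∈ unused q F J) with hRdef
  have hRmem : ∀ v, v ∈ R ↔ v ∈ unused q F J := by simp [hRdef]
  have hcard : Fintype.card V ≤ R.card + 8 * d := card_unused q F J
  obtain ⟨p, hp⟩ : R.Nonempty := by
    rw [← Finset.card_pos]
    omega
  have hcard' : (R.erase p).card + 1 = R.card := Finset.card_erase_add_one hp
  -- Two equally coloured edges at `p` make the constant `k` a single basis vector, hence at most
  -- one odd colour in the end.
  obtain ⟨x, hx, y, hy, hxy, hcol⟩ := Finset.exists_ne_map_eq_of_card_lt_of_maps_to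
    (s := R.erase p) (t := (Finset.univ : Finset (Fin r))) (f := fun v => c v p) (by
      rw [Finset.card_univ, Fintype.card_fin]
      omega) (fun _ _ => Finset.mem_coe.2 (Finset.mem_univ _))
  rw [Finset.mem_erase, hRmem] at hx hy
  rw [hRmem] at hp
  set A : Finset V := (Finset.univ.filter (· ∉ J)).biUnion fun j => Finset.univ.image (q j) with hA
  have hAmem : ∀ v, v ∈ A ↔ ∃ j ∈ Finset.univ.filter (· ∉ J), ∃ a, q j a = v := by simp [hA]
  -- The singletons: `p` itself and the vertices of discarded quadruples and of their replacements.
  set Z : Finset V := (Finset.univ \ R.erase p) \ A with hZ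
  set Lq := (Finset.univ.filter (· ∉ J)).toList.map
    fun j => swapBlock hc [] (q j 0) (q j 1) (q j 2) (q j 3) with hLq
  set Lz := Z.toList.map (singleBlock c) with hLz
  have hUL : U ≤ flipSpan (Lq ++ Lz) := by
    refine Submodule.span_le.2 ?_
    rintro _ ⟨j, hj, rfl⟩
    refine Submodule.subset_span
      ⟨swapBlock hc [] (q j 0) (q j 1) (q j 2) (q j 3), ?_, rfl⟩
    simp only [hLq, List.mem_append, List.mem_map, Finset.mem_toList, Finset.mem_filter,
      Finset.mem_univ, true_and]
    exact Or.inl ⟨j, hj, rfl⟩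
  have hPmem : ∀ v, v ∈ (R.erase p).toList ↔ v ≠ p ∧ v ∈ unused q F J := by
    intro v
    rw [Finset.mem_toList, Finset.mem_erase, hRmem]
  refine ⟨p, c x y, Lq ++ Lz, (R.erase p).toList, ⟨?_, ?_, ?_⟩, ?_, ?_⟩
  · rw [List.flatMap_append, hLz, flatMap_singleBlock]
    have hdisj : ∀ v ∈ A, v ∉ R.erase p := by
      intro v hv hvR
      obtain ⟨j, -, a, rfl⟩ := (hAmem v).1 hv
      exact (((hRmem _).1 (Finset.mem_erase.1 hvR).2) j a).1 rfl
    have hAL : ∀ v, v ∈ Lq.flatMap Block.s ↔ v ∈ A := fun v =>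
      (mem_flatMap_swapBlock hc _ v).trans (hAmem v).symm
    refine (List.perm_ext_iff_of_nodup ?_ (Finset.nodup_toList _)).2 ?_
    · refine List.Nodup.append (List.Nodup.append (nodup_flatMap_swapBlock hc hq _)
        (Finset.nodup_toList _) ?_) (Finset.nodup_toList _) ?_
      · intro v h1 h2
        rw [Finset.mem_toList, hZ, Finset.mem_sdiff] at h2
        exact h2.2 ((hAL v).1 h1)
      · intro v h1 h2
        rw [Finset.mem_toList] at h2
        rcases List.mem_append.1 h1 with h1 | h1
        · exact hdisj v ((hAL v).1 h1) h2
        · rw [Finset.mem_toList, hZ, Finset.mem_sdiff, Finset.mem_sdiff] at h1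
          exact h1.1.2 h2
    · intro v
      simp only [List.mem_append, hAL, Finset.mem_toList, hZ, Finset.mem_sdiff, Finset.mem_univ,
        true_and]
      tauto
  · intro v hv w hw hvw
    rw [hPmem] at hv hw
    exact hUL (edgeVec_add_mem_of_quadVec_mem hc hR hp hx.2 hy.2 hxy hx.1 hy.1 hcol hv.2 hw.2 hvw
      hv.1 hw.1)
  · intro b hb
    rcases List.mem_append.1 hb with hb | hb
    · left
      simp only [hLq, List.mem_map, Finset.mem_toList, Finset.mem_filter, Finset.mem_univ,
        true_and] at hb
      obtain ⟨j, hj, rfl⟩ := hb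
      set S : Set V := {v | v ∈ unused q F J ∨ ∃ b, v = q j b} with hS
      have hgood : ∀ v ∈ S, ∀ w ∈ S, v ≠ w → v ≠ p → w ≠ p → _ ∈ U := fun v hv w hw hvw hvp hwp =>
        edgeVec_add_mem_of_quadVec_mem hc (S := S) (fun f hf hfS => hRq j hj f hf hfS) (Or.inl hp)
          (Or.inl hx.2) (Or.inl hy.2) hxy hx.1 hy.1 hcol hv hw hvw hvp hwp
      have hqS : ∀ a, q j a ∈ S := fun a => Or.inr ⟨a, rfl⟩
      have hqR : ∀ a v, v ∈ unused q F J → q j a ≠ v := fun a v hv => (hv j a).1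
      have hqq : ∀ a b, a ≠ b → q j a ≠ q j b := fun a b hab h => hab (hq' j j a b h).2
      intro v hv w hw _
      rw [hPmem] at hv hw
      have e1 := hgood v (Or.inl hv.2) _ (hqS 0) (hqR 0 v hv.2).symm hv.1 (hqR 0 p hp)
      have e2 := hgood _ (hqS 0) _ (hqS 1) (hqq 0 1 (by decide)) (hqR 0 p hp) (hqR 1 p hp)
      have e3 := hgood _ (hqS 1) _ (hqS 2) (hqq 1 2 (by decide)) (hqR 1 p hp) (hqR 2 p hp)
      have e4 := hgood _ (hqS 2) _ (hqS 3) (hqq 2 3 (by decide)) (hqR 2 p hp) (hqR 3 p hp)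
      have e5 := hgood _ (hqS 3) w (Or.inl hw.2) (hqR 3 w hw.2) (hqR 3 p hp) hw.1
      refine hUL ?_
      convert U.add_mem e1 (U.add_mem e2 (U.add_mem e3 (U.add_mem e4 e5))) using 1
      simp only [swapBlock, List.cons_append, List.nil_append, pathVec, List.length_cons,
        List.length_nil]
      push_cast
      change _ + (edgeVec c v p + edgeVec c x y) + (edgeVec c w p + edgeVec c x y)
        + (0 + 1 + 1 + 1 + 1 + 1) * edgeVec c x y = _
      linear_combination (-edgeVec c (q j 0) p - edgeVec c (q j 1) p - edgeVec c (q j 2) p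
        - edgeVec c (q j 3) p - 4 * edgeVec c x y) * two_eq_zero (r := r)
    · right
      simp only [hLz, List.mem_map] at hb
      obtain ⟨w, -, rfl⟩ := hb
      exact ⟨w, rfl⟩
  -- At most `d` kept quadruples and `8 * d + 1` singletons, with `d ≤ r`.
  · have h1 : (Finset.univ.filter (· ∉ J)).card ≤ d := (Finset.card_le_univ _).trans (by simp)
    have h2 : Z.card ≤ Fintype.card V - (R.erase p).card := by
      refine (Finset.card_le_card Finset.sdiff_subset).trans ?_
      rw [Finset.card_sdiff_of_subset (Finset.subset_univ _), Finset.card_univ]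
    simp only [hLq, hLz, List.length_append, List.length_map, Finset.length_toList]
    omega
  · rw [Finset.length_toList]
    omega

/-- The hypothesis on the size is generous: the steps need only `r ^ 2 + O(r)` vertices, for the
pigeonhole and for a pool at least as large as the list of blocks. -/
theorem exists_cyclic_list [Fintype V] {c : V → V → Fin r} (hc : ∀ x y, c x y = c y x)
    (hr : 1 ≤ r) (hn : 2 * r ^ 2 + 40 * r ≤ Fintype.card V) :
    ∃ (x : V) (l : List V) (i : Fin r), (x :: l).Perm Finset.univ.toList ∧
      pathVec c (x :: l ++ [x]) = (Fintype.card V : Fin r → ZMod 2) * Pi.single i 1 := by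
  classical
  obtain ⟨p, i, L, P, hL, hLlen, hPlen⟩ := exists_isLayout hc (by nlinarith)
  obtain ⟨L', P', h1, h2, h3, h4⟩ := hL.exists_neutral hc (φ := fun v => c v p)
    (fun x y h => by simp only [edgeVec, h]) r L P (by omega) (by nlinarith)
  obtain ⟨x, l, h5, h6⟩ := h3.exists_cyclic_list h4 (by nlinarith) (by nlinarith)
  exact ⟨x, l, i, h5, h6⟩

end Core

/-! ### Translation to Hamilton cycles and odd-Ramsey numbers. -/

section Walks

open SimpleGraph

variable {V : Type*} {r : ℕ}

theorem exists_walk_of_isChain (c : Sym2 V → Fin r) : ∀ (l : List V) (a b : V),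
    (a :: (l ++ [b])).IsChain (· ≠ ·) → ∃ p : (⊤ : SimpleGraph V).Walk a b,
      p.support = a :: (l ++ [b]) ∧ ∀ i, pathVec (fun x y => c s(x, y)) (a :: (l ++ [b])) i =
        (p.edges.countP (c · = i) : ZMod 2)
  | [], a, b, h => by
    have hab : (⊤ : SimpleGraph V).Adj a b := by simpa using h
    refine ⟨Walk.cons hab Walk.nil, by simp, fun i => ?_⟩
    by_cases hi : c s(a, b) = i
    · subst hi
      simp [pathVec, edgeVec]
    · simp [pathVec, edgeVec, hi, Ne.symm hi]
  | d :: l, a, b, h => by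
    simp only [List.cons_append, List.isChain_cons_cons] at h
    have had : (⊤ : SimpleGraph V).Adj a d := by simpa using h.1
    obtain ⟨p, hp, hpe⟩ := exists_walk_of_isChain c l d b h.2
    refine ⟨Walk.cons had p, by simp [hp], fun i => ?_⟩
    simp only [List.cons_append, pathVec, Pi.add_apply, hpe, Walk.edges_cons, List.countP_cons]
    by_cases hi : c s(a, d) = i
    · subst hi
      simp [edgeVec, add_comm]
    · simp [edgeVec, hi, Ne.symm hi]

theorem ncard_colourClass {G : SimpleGraph V} {K : Type*} [DecidableEq K] (c : G.EdgeLabeling K)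
    (c' : Sym2 V → K) (hc : ∀ e : G.edgeSet, c' e = c e) {u v : V} (p : G.Walk u v)
    (hp : p.edges.Nodup) (i : K) :
    (colourClass c p.toSubgraph i).ncard = p.edges.countP (c' · = i) := by
  classical
  rw [← Set.ncard_image_of_injective _ Subtype.val_injective]
  have : Subtype.val '' colourClass c p.toSubgraph i =
      ((p.edges.filter (c' · = i)).toFinset : Set (Sym2 V)) := by
    ext e
    simp only [colourClass, Set.mem_image, Set.mem_ofPred_eq, Walk.mem_edges_toSubgraph,
      Subtype.exists, exists_and_right, exists_eq_right, List.coe_toFinset, List.mem_filter,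
      decide_eq_true_eq]
    constructor
    · rintro ⟨h, h1, h2⟩
      exact ⟨h1, (hc ⟨e, h⟩).trans h2⟩
    · rintro ⟨h1, h2⟩
      exact ⟨p.edges_subset_edgeSet h1, h1, (hc ⟨e, _⟩).symm.trans h2⟩
  rw [this, Set.ncard_coe_finset, List.toFinset_card_of_nodup (hp.filter _),
    List.countP_eq_length_filter]

/-- Every edge-colouring of a large complete graph has a Hamilton cycle with at most one odd
colour class, and with none if the number of vertices is even. -/
theorem exists_isHamiltonianCycle {n : ℕ} (hr : 1 ≤ r) (hn : 2 * r ^ 2 + 40 * r ≤ n)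
    (c : (⊤ : SimpleGraph (Fin n)).EdgeLabeling (Fin r)) :
    ∃ (v : Fin n) (p : (⊤ : SimpleGraph (Fin n)).Walk v v), p.IsHamiltonianCycle ∧
      (oddColours c p.toSubgraph).ncard ≤ 1 ∧ (Even n → oddColours c p.toSubgraph = ∅) := by
  classical
  -- The value on loops is a dummy, since no walk uses them.
  let c' : Sym2 (Fin n) → Fin r := fun e =>
    if h : e ∈ (⊤ : SimpleGraph (Fin n)).edgeSet then c ⟨e, h⟩ else ⟨0, hr⟩
  have hc' : ∀ e : (⊤ : SimpleGraph (Fin n)).edgeSet, c' e = c e := fun e => dif_pos e.2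
  obtain ⟨x, l, i, hl, hv⟩ := exists_cyclic_list (c := fun x y => c' s(x, y))
    (fun x y => by rw [Sym2.eq_swap]) hr (by simpa using hn)
  have hnd : (x :: l).Nodup := hl.nodup_iff.2 (Finset.nodup_toList _)
  have hlen : l.length + 1 = n := by simpa using hl.length_eq
  have hl0 : l ≠ [] := by
    rintro rfl
    simp only [List.length_nil] at hlen
    nlinarith
  have hnd' : (l ++ [x]).Nodup := (List.perm_append_singleton x l).nodup_iff.2 hnd
  have hch : (x :: (l ++ [x])).IsChain (· ≠ ·) := by
    rw [List.isChain_cons]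
    refine ⟨fun y hy => ?_, hnd'.isChain⟩
    rw [List.head?_append_of_ne_nil _ hl0] at hy
    rintro rfl
    exact (List.nodup_cons.1 hnd).1 (List.mem_of_mem_head? hy)
  obtain ⟨p, hp, hpe⟩ := exists_walk_of_isChain c' l x x hch
  have hplen : p.length = n := by
    have := p.length_support
    rw [hp] at this
    simp only [List.length_cons, List.length_append, List.length_nil] at this
    omega
  have hnil : ¬ p.Nil := by
    rw [Walk.not_nil_iff_lt_length]
    omega
  have hcyc : p.IsCycle := by
    refine Walk.isCycle_iff_isPath_tail_and_le_length.2 ⟨Walk.IsPath.mk' ?_, ?_⟩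
    · rw [Walk.support_tail_of_not_nil _ hnil, hp]
      exact hnd'
    · rw [hplen]
      nlinarith
  have hodd : ∀ j, Odd (colourClass c p.toSubgraph j).ncard ↔
      ((n : Fin r → ZMod 2) * (Pi.single i 1 : Fin r → ZMod 2)) j = 1 := by
    intro j
    have h := congrFun hv j
    rw [List.cons_append, hpe, Fintype.card_fin] at h
    rw [ncard_colourClass c c' hc' p hcyc.edges_nodup, ← h, ZMod.natCast_eq_one_iff_odd]
  refine ⟨x, p, Walk.isHamiltonianCycle_iff_isCycle_and_length_eq.2
    ⟨hcyc, by simpa using hplen⟩, ?_, fun hev => ?_⟩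
  · rw [Set.ncard_le_one]
    have : ∀ j ∈ oddColours c p.toSubgraph, j = i := by
      intro j hj
      have h := (hodd j).1 hj
      by_contra hji
      simp [hji] at h
    intro a ha b hb
    rw [this a ha, this b hb]
  · ext j
    simp only [Set.mem_empty_iff_false, iff_false]
    intro hj
    have h := (hodd j).1 hj
    have h0 : (n : ZMod 2) = 0 := (ZMod.natCast_eq_zero_iff_even).2 hev
    simp [h0] at h

theorem exists_copy_cycleGraph {n : ℕ} {v : V} (p : (⊤ : SimpleGraph V).Walk v v)
    (hp : p.IsCycle) (hn : p.length = n) :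
    ∃ f : Copy (cycleGraph n) (⊤ : SimpleGraph V), f.toSubgraph.edgeSet = p.toSubgraph.edgeSet := by
  have h3 := hp.three_le_length
  have hinj : Function.Injective fun i : Fin n => p.getVert i := by
    intro i j hij
    exact Fin.ext (hp.getVert_injOn' (by simp only [Set.mem_ofPred_eq]; omega)
      (by simp only [Set.mem_ofPred_eq]; omega) hij)
  have hend : p.getVert n = p.getVert 0 := by
    rw [← hn, Walk.getVert_length, Walk.getVert_zero]
  refine ⟨⟨⟨fun i => p.getVert i, fun {i j} h => hinj.ne h.ne⟩, hinj⟩, ?_⟩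
  have hfwd : ∀ i j : Fin n, (i - j).val = 1 →
      s(p.getVert j, p.getVert i) ∈ p.toSubgraph.edgeSet := by
    intro i j h
    have hi : p.getVert i = p.getVert (j + 1) := by
      rw [Fin.val_sub] at h
      by_cases hj : j.val + 1 = n
      · have hi0 : i.val = 0 := by
          by_contra hi0
          rw [show n - j.val + i.val = i.val + 1 by omega] at h
          by_cases hi' : i.val + 1 = n
          · rw [hi', Nat.mod_self] at h
            omega
          · rw [Nat.mod_eq_of_lt (by omega)] at h
            omega
        rw [hi0, hj, hend]
      · congr 1
        by_cases hij : j.val ≤ i.val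
        · rw [show n - j.val + i.val = (i.val - j.val) + n by omega, Nat.add_mod_right,
            Nat.mod_eq_of_lt (by omega)] at h
          omega
        · rw [Nat.mod_eq_of_lt (by omega)] at h
          omega
    rw [hi]
    exact p.toSubgraph_adj_getVert (by omega)
  ext e
  induction e with
  | h u w =>
    rw [Subgraph.mem_edgeSet, Subgraph.map_adj, Relation.map_apply]
    constructor
    · rintro ⟨i, j, h, rfl, rfl⟩
      rcases cycleGraph_adj'.1 h with h | h
      · rw [Sym2.eq_swap]
        exact hfwd i j h
      · exact hfwd j i h
    · intro h
      rw [Subgraph.mem_edgeSet, Walk.toSubgraph_adj_iff] at h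
      obtain ⟨m, hm, hmn⟩ := h
      have key : ∃ i j : Fin n, (cycleGraph n).Adj i j ∧ p.getVert i = p.getVert m ∧
          p.getVert j = p.getVert (m + 1) := by
        by_cases hm' : m + 1 = n
        · refine ⟨⟨m, by omega⟩, ⟨0, by omega⟩, cycleGraph_adj'.2 (Or.inr ?_), rfl, ?_⟩
          · rw [Fin.val_sub]
            simp only
            rw [Nat.mod_eq_of_lt (by omega)]
            omega
          · rw [hm', hend]
        · refine ⟨⟨m, by omega⟩, ⟨m + 1, by omega⟩, cycleGraph_adj'.2 (Or.inr ?_), rfl, rfl⟩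
          rw [Fin.val_sub]
          simp only
          rw [show n - m + (m + 1) = 1 + n by omega, Nat.add_mod_right,
            Nat.mod_eq_of_lt (by omega)]
      obtain ⟨i, j, hij, hi, hj⟩ := key
      rcases Sym2.eq_iff.1 hm with ⟨h1, h2⟩ | ⟨h1, h2⟩
      · exact ⟨i, j, hij, hi.trans h1, hj.trans h2⟩
      · exact ⟨j, i, hij.symm, hj.trans h2, hi.trans h1⟩

theorem oddColours_congr {K : Type*} [Finite V] {G : SimpleGraph V} (c : G.EdgeLabeling K)
    {S T : G.Subgraph} (h : S.edgeSet = T.edgeSet) : oddColours c S = oddColours c T := by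
  simp only [oddColours, colourClass, h]

/-- The infimum is attained because the rainbow colouring makes every colour class of a copy have at
most one edge. -/
theorem oddRamsey_spec {n : ℕ} (hn : 4 ≤ n) :
    1 ≤ oddRamsey (⊤ : SimpleGraph (Fin n)) (cycleGraph n) ∧
      ∃ c : (⊤ : SimpleGraph (Fin n)).EdgeLabeling
        (Fin (oddRamsey (⊤ : SimpleGraph (Fin n)) (cycleGraph n))),
        ∀ f : Copy (cycleGraph n) (⊤ : SimpleGraph (Fin n)),
          (oddColours c f.toSubgraph).Nonempty := by
  classical
  refine Nat.sInf_mem (s := {r : ℕ | 1 ≤ r ∧ ∃ c : (⊤ : SimpleGraph (Fin n)).EdgeLabeling (Fin r),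
    ∀ f : Copy (cycleGraph n) (⊤ : SimpleGraph (Fin n)), (oddColours c f.toSubgraph).Nonempty}) ?_
  let a : Fin n := ⟨0, by omega⟩
  let b : Fin n := ⟨1, by omega⟩
  have hab : (cycleGraph n).Adj a b := by
    rw [cycleGraph_adj']
    right
    rw [Fin.val_sub]
    simp only [a, b]
    rw [show n - 0 + 1 = 1 + n by omega, Nat.add_mod_right, Nat.mod_eq_of_lt (by omega)]
  have hE : 0 < Fintype.card (⊤ : SimpleGraph (Fin n)).edgeSet :=
    Fintype.card_pos_iff.2 ⟨⟨s(a, b), by simpa using hab.ne⟩⟩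
  let c : (⊤ : SimpleGraph (Fin n)).EdgeLabeling
      (Fin (Fintype.card (⊤ : SimpleGraph (Fin n)).edgeSet)) :=
    ⇑(Fintype.equivFin (⊤ : SimpleGraph (Fin n)).edgeSet)
  have hc : ∀ e e', c e = c e' → e = e' := fun e e' h => (Fintype.equivFin _).injective h
  refine ⟨_, hE, c, fun f => ?_⟩
  let e : (⊤ : SimpleGraph (Fin n)).edgeSet := ⟨s(f.toHom a, f.toHom b), f.toHom.map_adj hab⟩
  refine ⟨c e, ?_⟩
  have : colourClass c f.toSubgraph (c e) = {e} := by
    ext e'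
    simp only [colourClass, Set.mem_ofPred_eq, Set.mem_singleton_iff]
    constructor
    · exact fun h => hc _ _ h.2
    · rintro rfl
      exact ⟨⟨a, b, hab, rfl, rfl⟩, rfl⟩
  change Odd _
  rw [this, Set.ncard_singleton]
  exact odd_one

theorem lt_of_even {n : ℕ} (hn : 4 ≤ n) (hev : Even n) :
    n < 2 * (oddRamsey (⊤ : SimpleGraph (Fin n)) (cycleGraph n)) ^ 2 +
      40 * oddRamsey (⊤ : SimpleGraph (Fin n)) (cycleGraph n) := by
  obtain ⟨h1, c, hc⟩ := oddRamsey_spec hn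
  by_contra! h
  obtain ⟨v, p, hp, -, hodd⟩ := exists_isHamiltonianCycle h1 h c
  obtain ⟨f, hf⟩ := exists_copy_cycleGraph p hp.isCycle (by simpa using hp.length_eq)
  have := hc f
  rw [oddColours_congr c hf, hodd hev] at this
  exact Set.not_nonempty_empty this

end Walks

end OddRamsey

theorem theorem3p4 :
    (∀ r n : ℕ, 2 ≤ r → 2 * (r : ℝ) ^ 2 + 40 * (r : ℝ) ^ (3 / 2 : ℝ) ≤ (n : ℝ) →
      ∀ c : (⊤ : SimpleGraph (Fin n)).EdgeLabeling (Fin r),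
        ∃ (v : Fin n) (p : (⊤ : SimpleGraph (Fin n)).Walk v v),
          p.IsHamiltonianCycle ∧ (OddRamsey.oddColours c p.toSubgraph).ncard ≤ 1) ∧
    ∃ ε : ℕ → ℝ, Filter.Tendsto ε Filter.atTop (nhds 0) ∧
      ∀ n : ℕ, 4 ≤ n → Even n →
        (Real.sqrt 2 / 2 + ε n) * Real.sqrt n ≤
          (OddRamsey.oddRamsey (⊤ : SimpleGraph (Fin n)) (SimpleGraph.cycleGraph n) : ℝ) := by
  constructor
  · intro r n hr hn c
    have hr1 : (1 : ℝ) ≤ r := by exact_mod_cast (by omega : 1 ≤ r)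
    -- The linear error term `40 * r` already suffices.
    have hpow : (r : ℝ) ≤ (r : ℝ) ^ (3 / 2 : ℝ) := by
      simpa using Real.rpow_le_rpow_of_exponent_le hr1 (by norm_num : (1 : ℝ) ≤ 3 / 2)
    have hn' : 2 * r ^ 2 + 40 * r ≤ n := by
      have : (2 * (r : ℝ) ^ 2 + 40 * r) ≤ n := by linarith
      exact_mod_cast this
    obtain ⟨v, p, hp, h1, -⟩ := OddRamsey.exists_isHamiltonianCycle (by omega) hn' c
    exact ⟨v, p, hp, h1⟩
  -- Completing the square: `n ≤ 2R² + 40R ≤ 2(R + 10)²`, so `√(n/2) ≤ R + 10`.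
  · refine ⟨fun n => -10 / Real.sqrt n, ?_, fun n hn hev => ?_⟩
    · exact Filter.Tendsto.const_div_atTop
        (Real.tendsto_sqrt_atTop.comp tendsto_natCast_atTop_atTop) _
    · have h := OddRamsey.lt_of_even hn hev
      set R := OddRamsey.oddRamsey (⊤ : SimpleGraph (Fin n)) (SimpleGraph.cycleGraph n)
      have hn0 : (0 : ℝ) < Real.sqrt n := Real.sqrt_pos.2 (by exact_mod_cast (by omega : 0 < n))
      have h' : (n : ℝ) ≤ 2 * (R : ℝ) ^ 2 + 40 * R := by exact_mod_cast h.le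
      have hs : Real.sqrt 2 / 2 * Real.sqrt n ≤ R + 10 := by
        refine le_of_sq_le_sq ?_ (by positivity)
        rw [mul_pow, div_pow, Real.sq_sqrt (by norm_num), Real.sq_sqrt (by positivity)]
        nlinarith
      rw [add_mul, div_mul_cancel₀ _ hn0.ne']
      linarith
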